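/- Let $V$ be a finite set of users of a social network, with a directed graph on $V$ in which an arc $(u,v)$ means that $v$ follows $u$, and let $u_0$ be a further user, who initially has no followers. For $v\in V$, let $r_v\in[0,1]$ be the probability that $v$ follows $u_0$ back if $u_0$ follows $v$, these events being independent of each other and of the cascade below, and let $p_v(u,S)\in[0,1]$ be the probability that $v$ reads and retweets a message (re)tweeted by $u$, given that the users in $S$ have already (re)tweeted it, for $u\in V\cup\{u_0\}$ and $S\subseteq V\cup\{u_0\}$, $u\notin S$, consisting of users that $v$ follows or could follow, namely of in-neighbours of $v$ in $V$ and possibly $u_0$. Assume that these form a decreasing, order-independent cascade: $p_v(u,S)\ge p_v(u,T)$ if $S\subseteq T$, and, for every $S$, the probability that the attempts of several further users on $v$, made one after the other after those of $S$, all fail does not depend on their order. If $F\subseteq V$ is the set of followers of $u_0$, the cascade starts with $u_0$ active (he tweets). In each step, all users who became active in the preceding step try, one after the other, to activate each of their inactive followers $v$; an attempt of $u$ succeeds with probability $p_v(u,S)$, where $S$ is the set of users followed by $v$ who have already tried, and the outcomes for different $v$ are independent in each step. When the cascade has stopped, let $\varphi$ be the set of active users in $V$ (the retweeters), and let $\psi$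 be the number of users $v\in V$ who see the tweet, i.e. who are active or follow an active user, possibly $u_0$. Let $g(F)$ denote either $\mathbb E|\varphi|$ or $\mathbb E[\psi]$ when $F$ is the set of followers of $u_0$. Let $K\ge 0$ be an integer. *Static problem.* $u_0$ selects once and for all a set $B\subseteq V$, $|B|\le K$, of users to follow, and maximizes $G(B)=\mathbb E[g(\{v\in B: v \text{ follows back}\})]$. The greedy algorithm makes $K$ selections one after the other (stopping earlier if no user is left), each of a new user with the largest marginal increment of $G$. *Dynamic problem.* Given the set $R\subseteq V$ of users who are willing to follow back, maximize $g(B)$ over all $B\subseteq R$ with $|B|\le K$. The greedy algorithm makes $K$ selections one after the other in $R$ (stopping earlier if none is left), each with the largest marginal increment of $g$. Its online version does not know $R$: it repeatedly follows a user, among all those not tried yet, with the largest marginal increment of $g$ with respect to the users kept so far, keeps this user if and only if he reciprocates, and stops when $K$ users are kept or all users have been tried. Then, for both objectives ($\mathbb E|\varphi|$, the expected number of retweets, and $\mathbb E[\psi]$, the expected number of users who see the tweet), the greedy algorithm, with ties broken arbitrarily, is a $(1-1/e)$-approximation algorithm for the static problem, and the greedy algorithm and its online version are $(1-1/e)$-approximation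 algorithms for the dynamic problem for every $R$: they return a feasible set $B$ whose objective value is at least $(1-1/e)$ times that of every feasible set. -/

import Mathlib

/-! # Cascades with decreasing, order-independent success probabilities -/

/-- A cascade on the nodes `W`. An edge `edge u v` means that `u` can try to activate `v`, and
`p v u S` is the probability that the attempt of `u` on `v` succeeds, given that the nodes of `S`
have already tried (in vain) to activate `v`. -/
structure CascadeModel (W : Type*) where
  edge : W → W → Prop
  p : W → W → Finset W → ℝ

/-- The probability that all the attempts of the nodes of the list, made in the order of the list
after the attempts of the nodes of `S`, fail. Here `q u S` is the success probability of `u`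
after `S`. -/
def failProb {W : Type*} [DecidableEq W] (q : W → Finset W → ℝ) : Finset W → List W → ℝ
  | _, [] => 1
  | S, u :: l => (1 - q u S) * failProb q (insert u S) l

/-- The probability that the random subset of `U` that contains every `v ∈ U` independently with
probability `q v` is equal to `N` (where `N ⊆ U`). -/
def subsetProb {W : Type*} [DecidableEq W] (U : Finset W) (q : W → ℝ) (N : Finset W) : ℝ :=
  (∏ v ∈ N, q v) * ∏ v ∈ U \ N, (1 - q v)

namespace CascadeModel

variable {W : Type*} [Fintype W] [DecidableEq W]

open Classical in
/-- The nodes that can try to activate `v`. -/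
noncomputable def inNbrs (M : CascadeModel W) (v : W) : Finset W :=
  Finset.univ.filter fun u => M.edge u v

/-- The decreasing, order-independent cascade model. -/
structure IsDecreasingCascade (M : CascadeModel W) : Prop where
  /-- The success probabilities are probabilities. -/
  p_mem : ∀ v, ∀ u ∈ M.inNbrs v, ∀ S ⊆ M.inNbrs v, u ∉ S → M.p v u S ∈ Set.Icc (0 : ℝ) 1
  /-- The order in which several nodes make their attempts on `v` is irrelevant. -/
  order_independent : ∀ v, ∀ S ⊆ M.inNbrs v, ∀ l l' : List W, l.Perm l' → l.Nodup →
    (∀ u ∈ l, u ∈ M.inNbrs v ∧ u ∉ S) → failProb (M.p v) S l = failProb (M.p v) S l'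
  /-- The success probability does not increase with the set of nodes that have already tried. -/
  decreasing : ∀ v, ∀ u ∈ M.inNbrs v, ∀ S T : Finset W, S ⊆ T → T ⊆ M.inNbrs v → u ∉ T →
    M.p v u T ≤ M.p v u S

/-- Suppose that `A` is the set of active nodes and that `C ⊆ A` is the set of contagious ones,
that is, of those that became active in the last step. The probability that an inactive node `v`
becomes active in the next step: its in-neighbours in `C` try to activate it one after the other
(in an arbitrary order), and its in-neighbours in `A \ C` have tried before. -/
noncomputable def activationProb (M : CascadeModel W) (A C : Finset W) (v : W) : ℝ :=
  1 - failProb (M.p v) ((A \ C) ∩ M.inNbrs v) (C ∩ M.inNbrs v).toList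

/-- The probability that, `n` steps after the active set is `A` with contagious set `C`, the active
set is `D`. In each step the inactive nodes become active independently of each other. -/
noncomputable def activeProb (M : CascadeModel W) :
    ℕ → Finset W → Finset W → Finset W → ℝ
  | 0, A, _, D => if D = A then 1 else 0
  | n + 1, A, C, D => ∑ N ∈ (Aᶜ).powerset,
      subsetProb Aᶜ (M.activationProb A C) N * M.activeProb n (A ∪ N) N D

/-- The expectation of `f D`, where `D` is the final set of active nodes of the cascade that starts
with the active set `A`. (No step after the first `|W|` ones changes the active set.) -/
noncomputable def expectFinal (M : CascadeModel W) (A : Finset W) (f : Finset W → ℝ) : ℝ :=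
  ∑ D : Finset W, M.activeProb (Fintype.card W) A A D * f D

end CascadeModel

/-! # The social network and its distinguished user -/

/-- A social network with users `V` and one further user, the distinguished user `u₀`. The type of
all users is `Option V`, where `none` stands for `u₀`. -/
structure SocialNetwork (V : Type*) where
  /-- `edge u v`: user `v` follows user `u`, so that `v` receives what `u` tweets or retweets. -/
  edge : V → V → Prop
  /-- `p v u S`: the probability that `v` reads and retweets the message (re)tweeted by `u`, given
  that the users of `S` have already (re)tweeted it. -/
  p : V → Option V → Finset (Option V) → ℝ
  /-- `r v`: the probability that `v` follows `u₀` back when `u₀` follows `v`. -/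
  r : V → ℝ

namespace SocialNetwork

variable {V : Type*}

/-- The edges of the network in which `F` is the set of followers of `u₀`. -/
def edgeWith (N : SocialNetwork V) (F : Finset V) : Option V → Option V → Prop
  | some u, some v => N.edge u v
  | none, some v => v ∈ F
  | _, none => False

/-- The retweet cascade when `F` is the set of followers of `u₀`. An active node is a user who has
(re)tweeted the message. No edge ends in `u₀`, so that the values `0` for `u₀` play no role. -/
def cascade (N : SocialNetwork V) (F : Finset V) : CascadeModel (Option V) where
  edge := N.edgeWith F
  p := fun v => v.elim (fun _ _ => 0) N.p

variable [Fintype V] [DecidableEq V]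

/-- The standing assumptions: the `r v` are probabilities, and the `p v u S`, also for `u = u₀`
or `u₀ ∈ S` and for every user `v`, are those of a decreasing, order-independent cascade. -/
structure IsAdmissible (N : SocialNetwork V) : Prop where
  r_mem : ∀ v, N.r v ∈ Set.Icc (0 : ℝ) 1
  isDecreasingCascade : (N.cascade Finset.univ).IsDecreasingCascade

/-- The users other than `u₀` who retweet, if `D` is the final set of active nodes. -/
def retweeters (D : Finset (Option V)) : Finset V :=
  Finset.univ.filter fun v => some v ∈ D

open Classical in
/-- The users other than `u₀` who see the tweet, if `F` is the set of followers of `u₀` and `D` is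
the final set of active nodes (including `u₀`): those who are active or follow an active user. -/
noncomputable def readers (N : SocialNetwork V) (F : Finset V) (D : Finset (Option V)) :
    Finset V :=
  Finset.univ.filter fun v => some v ∈ D ∨ ∃ w ∈ D, N.edgeWith F w (some v)

/-- The expected number of retweets when `F` is the set of followers of `u₀`, who tweets. -/
noncomputable def expRetweets (N : SocialNetwork V) (F : Finset V) : ℝ :=
  (N.cascade F).expectFinal {none} fun D => ((retweeters D).card : ℝ)

/-- The expected number of users who see the tweet when `F` is the set of followers of `u₀`. -/
noncomputable def expReaders (N : SocialNetwork V) (F : Finset V) : ℝ :=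
  (N.cascade F).expectFinal {none} fun D => ((N.readers F D).card : ℝ)

/-- The expectation of `g F` when `u₀` follows the users of `B` once and for all: each `v ∈ B`
becomes a follower of `u₀` with probability `r v`, independently of all else. In the sum, `R` is
the set of users who are willing to follow back. -/
noncomputable def expFollowBack (N : SocialNetwork V) (g : Finset V → ℝ) (B : Finset V) : ℝ :=
  ∑ R : Finset V, subsetProb Finset.univ N.r R * g (B ∩ R)

end SocialNetwork

/-! # Greedy algorithms and approximation ratios -/

/-- `GreedyRun f U k B`: the greedy algorithm that in each step adds to the set selected so far an
element of `U` with the largest marginal gain of `f` (ties being broken arbitrarily), and does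
nothing if all of `U` is selected, can have selected `B` after `k` steps. -/
inductive GreedyRun {V : Type*} [DecidableEq V] (f : Finset V → ℝ) (U : Finset V) :
    ℕ → Finset V → Prop
  | start : GreedyRun f U 0 ∅
  | select {k : ℕ} {B : Finset V} {v : V} : GreedyRun f U k B → v ∈ U → v ∉ B →
      (∀ w ∈ U, w ∉ B → f (insert w B) - f B ≤ f (insert v B) - f B) →
      GreedyRun f U (k + 1) (insert v B)
  | exhausted {k : ℕ} {B : Finset V} : GreedyRun f U k B → U ⊆ B → GreedyRun f U (k + 1) B

/-- `OnlineGreedyRun f K R T B`: the online greedy algorithm, which does not know the set `R` of the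
users who are willing to reciprocate, can reach the state in which it has tried the users of `T` and
keeps those of `B`. As long as it keeps fewer than `K` users, it tries a new user `v` with the
largest marginal gain of `f` among all users not tried yet, and keeps `v` if `v` reciprocates. -/
inductive OnlineGreedyRun {V : Type*} [DecidableEq V] (f : Finset V → ℝ) (K : ℕ) (R : Finset V) :
    Finset V → Finset V → Prop
  | start : OnlineGreedyRun f K R ∅ ∅
  | keep {T B : Finset V} {v : V} : OnlineGreedyRun f K R T B → B.card < K → v ∉ T →
      (∀ w, w ∉ T → f (insert w B) - f B ≤ f (insert v B) - f B) → v ∈ R →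
      OnlineGreedyRun f K R (insert v T) (insert v B)
  | drop {T B : Finset V} {v : V} : OnlineGreedyRun f K R T B → B.card < K → v ∉ T →
      (∀ w, w ∉ T → f (insert w B) - f B ≤ f (insert v B) - f B) → v ∉ R →
      OnlineGreedyRun f K R (insert v T) B

/-- The online greedy algorithm stops when `K` users reciprocate or all users have been tried. -/
def OnlineGreedyOutput {V : Type*} [Fintype V] [DecidableEq V] (f : Finset V → ℝ) (K : ℕ)
    (R B : Finset V) : Prop :=
  ∃ T, OnlineGreedyRun f K R T B ∧ (B.card = K ∨ T = Finset.univ)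

/-- `B` is a solution with approximation ratio `ρ` of the problem of maximizing `f` over the sets
that satisfy `P`. -/
def IsApproxSolution {V : Type*} (f : Finset V → ℝ) (P : Finset V → Prop) (ρ : ℝ)
    (B : Finset V) : Prop :=
  P B ∧ ∀ B', P B' → ρ * f B' ≤ f B

/-- For the objective that has the expectation `g F` when `F` is the set of followers of `u₀`, the
greedy algorithm has approximation ratio `ρ` in the static problem. -/
def StaticGreedyRatio {V : Type*} [Fintype V] [DecidableEq V] (N : SocialNetwork V)
    (g : Finset V → ℝ) (K : ℕ) (ρ : ℝ) : Prop :=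
  ∀ B, GreedyRun (N.expFollowBack g) Finset.univ K B →
    IsApproxSolution (N.expFollowBack g) (fun B' => B'.card ≤ K) ρ B

/-- The same for the dynamic problem, in which `u₀` keeps at most `K` followings, all of them
reciprocating: for every realization `R` of the set of users who are willing to reciprocate, both the
greedy algorithm that knows `R` and the online one have approximation ratio `ρ` with respect to the
best choice with knowledge of `R`. -/
def DynamicGreedyRatio {V : Type*} [Fintype V] [DecidableEq V]
    (g : Finset V → ℝ) (K : ℕ) (ρ : ℝ) : Prop :=
  ∀ R B : Finset V, GreedyRun g R K B ∨ OnlineGreedyOutput g K R B →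
    IsApproxSolution g (fun B' => B'.card ≤ K ∧ B' ⊆ R) ρ B

/-! Both greedy claims reduce to one fact: `g` is monotone and submodular in the set `F` of
followers. The static objective is then a convex combination of the functions `B ↦ g (B ∩ R)`, the
kept users of an online run form a greedy run inside `R`, and `GreedyRun.isApproxSolution` applies
to each.

`F` enters the cascade through its edges, not its seeds. To change this, `u₀` is split into copies
`Sum.inl v`, each able to influence only `v`; the follower set `F` becomes the seed set `F.map inl`
of a fixed cascade (`expectFinal_cascade`). Both objectives are expectations of coverage functions
of the final set.

It remains to show that a decreasing, order-independent cascade preserves monotone submodularity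
(`isMonotoneSubmodular_kernelFinal`). A state is a pair `T ⊆ A`: the nodes of `A` are active, those
of `T` have already tried. By order independence some active nodes may wait (`kernelFinal_delay`),
even until the others' cascade has stopped (`kernelFinal_union`). Hence the gain from extra seeds
`X` is the expected gain of a residual cascade started by `X` after the final set `D` of the first
one. A coupling shows that this residual gain decreases in `D` (`kernelFinal_gain_le`), and larger
seed sets lead to larger `D`. -/

/-! # Expectations over random subsets with independent elements -/

/-- The expectation of `G N`, where `N` is the random subset of `U` that contains every `v ∈ U`
independently with probability `q v`. -/
def expectSubset {W : Type*} [DecidableEq W] (U : Finset W) (q : W → ℝ) (G : Finset W → ℝ) : ℝ :=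
  ∑ N ∈ U.powerset, subsetProb U q N * G N

section expectSubset

variable {W : Type*} [DecidableEq W]

lemma expectSubset_empty (q : W → ℝ) (G : Finset W → ℝ) : expectSubset ∅ q G = G ∅ := by
  simp [expectSubset, subsetProb]

lemma expectSubset_insert {U : Finset W} {a : W} (ha : a ∉ U) (q : W → ℝ) (G : Finset W → ℝ) :
    expectSubset (insert a U) q G =
      (1 - q a) * expectSubset U q G + q a * expectSubset U q fun N => G (insert a N) := by
  unfold expectSubset
  rw [Finset.sum_powerset_insert ha, Finset.mul_sum, Finset.mul_sum]
  congr 1 <;> refine Finset.sum_congr rfl fun N hN => ?_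
  · have hN' := Finset.mem_powerset.1 hN
    have haN : a ∉ N := fun h => ha (hN' h)
    rw [subsetProb, subsetProb, Finset.insert_sdiff_of_notMem _ haN,
      Finset.prod_insert (by simp [ha])]
    ring
  · have hN' := Finset.mem_powerset.1 hN
    have haN : a ∉ N := fun h => ha (hN' h)
    have h : insert a U \ insert a N = U \ N := by
      ext x
      simp only [Finset.mem_sdiff, Finset.mem_insert]
      grind
    rw [subsetProb, subsetProb, h, Finset.prod_insert haN]
    ring

lemma expectSubset_congr {U : Finset W} {q q' : W → ℝ} {G G' : Finset W → ℝ}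
    (hq : ∀ v ∈ U, q v = q' v) (hG : ∀ N ⊆ U, G N = G' N) :
    expectSubset U q G = expectSubset U q' G' := by
  refine Finset.sum_congr rfl fun N hN => ?_
  have hN' := Finset.mem_powerset.1 hN
  rw [hG N hN', subsetProb, subsetProb, Finset.prod_congr rfl fun v hv => hq v (hN' hv),
    Finset.prod_congr rfl fun v hv => congrArg (1 - ·) (hq v (Finset.mem_sdiff.1 hv).1)]

lemma expectSubset_mono {U : Finset W} {q : W → ℝ} {G G' : Finset W → ℝ}
    (hq : ∀ v, q v ∈ Set.Icc (0 : ℝ) 1) (hG : ∀ N ⊆ U, G N ≤ G' N) :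
    expectSubset U q G ≤ expectSubset U q G' := by
  refine Finset.sum_le_sum fun N hN => ?_
  refine mul_le_mul_of_nonneg_left (hG N (Finset.mem_powerset.1 hN)) (mul_nonneg ?_ ?_)
  · exact Finset.prod_nonneg fun v _ => (hq v).1
  · exact Finset.prod_nonneg fun v _ => sub_nonneg.2 (hq v).2

lemma expectSubset_sub (U : Finset W) (q : W → ℝ) (G G' : Finset W → ℝ) :
    (expectSubset U q fun N => G N - G' N) = expectSubset U q G - expectSubset U q G' := by
  simp only [expectSubset, mul_sub, Finset.sum_sub_distrib]

lemma expectSubset_const (U : Finset W) (q : W → ℝ) (c : ℝ) :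
    (expectSubset U q fun _ => c) = c := by
  induction U using Finset.induction_on with
  | empty => rw [expectSubset_empty]
  | insert a U ha ih => rw [expectSubset_insert ha, ih]; ring

lemma expectSubset_zero (U : Finset W) (G : Finset W → ℝ) :
    expectSubset U (fun _ => 0) G = G ∅ := by
  induction U using Finset.induction_on with
  | empty => rw [expectSubset_empty]
  | insert a U ha ih => rw [expectSubset_insert ha, ih]; ring

/-- The union of two independent random sets is again a random set with independent elements. -/
lemma expectSubset_comp (U : Finset W) (q₁ q₂ : W → ℝ) (G : Finset W → ℝ) :
    (expectSubset U q₁ fun N₁ => expectSubset U q₂ fun N₂ => G (N₁ ∪ N₂)) =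
      expectSubset U (fun v => 1 - (1 - q₁ v) * (1 - q₂ v)) G := by
  induction U using Finset.induction_on generalizing G with
  | empty => simp only [expectSubset_empty, Finset.union_empty]
  | insert a U ha ih =>
    have h (c d : ℝ) (G₁ G₂ : Finset W → ℝ) :
        (expectSubset U q₁ fun N => c * G₁ N + d * G₂ N) =
          c * expectSubset U q₁ G₁ + d * expectSubset U q₁ G₂ := by
      simp only [expectSubset, mul_add, Finset.sum_add_distrib, Finset.mul_sum]
      congr 1 <;> exact Finset.sum_congr rfl fun _ _ => by ring
    simp only [expectSubset_insert ha, Finset.union_insert, Finset.insert_union,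
      Finset.insert_idem, h, ih G, ih fun N => G (insert a N)]
    ring

/-- Comparison of two random sets, the elements of the second being more likely. -/
lemma expectSubset_le_of_le {U : Finset W} {q q' : W → ℝ} {G G' : Finset W → ℝ}
    (hq : ∀ v, q v ∈ Set.Icc (0 : ℝ) 1) (hq' : ∀ v, q' v ∈ Set.Icc (0 : ℝ) 1)
    (hle : ∀ v, q v ≤ q' v) (hG : ∀ N N' : Finset W, N ⊆ N' → G N ≤ G' N') :
    expectSubset U q G ≤ expectSubset U q' G' := by
  -- `s v` is the conditional probability of adding `v` when the first draw missed it, so that `1 -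
  -- q' = (1 - q) * (1 - s)`. If `q v = 1`, then `q' v = 1` too, and the value of `s v` is
  -- irrelevant.
  set s : W → ℝ := fun v => (q' v - q v) / (1 - q v) with hs
  have hs_mem : ∀ v, s v ∈ Set.Icc (0 : ℝ) 1 := fun v =>
    ⟨div_nonneg (sub_nonneg.2 (hle v)) (sub_nonneg.2 (hq v).2),
      div_le_one_of_le₀ (by linarith [(hq' v).2]) (sub_nonneg.2 (hq v).2)⟩
  have hcomp : expectSubset U q' G' =
      expectSubset U q fun N₁ => expectSubset U s fun N₂ => G' (N₁ ∪ N₂) := by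
    rw [expectSubset_comp]
    refine expectSubset_congr (fun v _ => ?_) fun _ _ => rfl
    rcases eq_or_ne (1 - q v) 0 with h | h
    · rw [h]; linarith [(hq' v).2, hle v]
    · have : (1 - q v) * s v = q' v - q v := by rw [hs]; field_simp
      linear_combination -this
  rw [hcomp]
  refine expectSubset_mono hq fun N _ => ?_
  rw [← expectSubset_const U s (G N)]
  exact expectSubset_mono hs_mem fun N₂ _ => hG _ _ Finset.subset_union_left

/-- Elements without influence on the function need not be drawn. -/
lemma expectSubset_union_of_insert_eq (U A : Finset W) (q : W → ℝ) (G : Finset W → ℝ)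
    (hG : ∀ a ∈ A, ∀ N, G (insert a N) = G N) :
    expectSubset (A ∪ U) q G = expectSubset U q G := by
  induction A using Finset.induction_on with
  | empty => rw [Finset.empty_union]
  | insert a A ha ih =>
    rw [Finset.insert_union]
    have ih' := ih fun b hb => hG b (Finset.mem_insert_of_mem hb)
    by_cases h : a ∈ A ∪ U
    · rw [Finset.insert_eq_of_mem h, ih']
    · rw [expectSubset_insert h]
      simp only [hG a (Finset.mem_insert_self a A)]
      rw [ih']
      ring

lemma expectSubset_map {V : Type*} [DecidableEq V] (ι : V ↪ W) (U : Finset V) (q : W → ℝ)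
    (G : Finset W → ℝ) :
    expectSubset (U.map ι) q G = expectSubset U (fun v => q (ι v)) fun N => G (N.map ι) := by
  induction U using Finset.induction_on generalizing G with
  | empty => simp only [Finset.map_empty, expectSubset_empty]
  | insert a U ha ih =>
    rw [Finset.map_insert, expectSubset_insert (by simpa using ha), expectSubset_insert ha, ih, ih]
    simp only [Finset.map_insert]

end expectSubset

/-! # Monotone submodular set functions -/

/-- A set function that is monotone and submodular. -/
structure IsMonotoneSubmodular {W : Type*} [DecidableEq W] (f : Finset W → ℝ) : Prop where
  mono : ∀ S T : Finset W, S ⊆ T → f S ≤ f T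
  submodular : ∀ S T X : Finset W, S ⊆ T → f (T ∪ X) - f T ≤ f (S ∪ X) - f S

/-- Coverage functions are monotone and submodular. -/
lemma isMonotoneSubmodular_card_biUnion {W V : Type*} [DecidableEq W] [DecidableEq V]
    (c : W → Finset V) : IsMonotoneSubmodular fun D : Finset W => ((D.biUnion c).card : ℝ) where
  mono S T h := by
    exact_mod_cast Finset.card_le_card (Finset.biUnion_subset_biUnion_of_subset_left c h)
  submodular S T X h := by
    have key (S : Finset W) : (((S ∪ X).biUnion c).card : ℝ) - (S.biUnion c).card =
        (X.biUnion c \ S.biUnion c).card := by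
      rw [Finset.union_biUnion, Finset.union_comm, ← Finset.card_sdiff_add_card]
      push_cast
      ring
    rw [key, key]
    exact_mod_cast Finset.card_le_card
      (Finset.sdiff_subset_sdiff le_rfl (Finset.biUnion_subset_biUnion_of_subset_left c h))

/-! # Cascades given by their activation probabilities -/

/-- The activation probabilities of a decreasing cascade with nodes `W`, in which the nodes in the
range of `ι` can be activated: `q T A v` is the probability that `ι v` is activated by the nodes
of `A \ T`, given that those of `T` have failed. -/
structure IsDecreasingKernel {V W : Type*} [DecidableEq W]
    (q : Finset W → Finset W → V → ℝ) : Prop where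
  mem_Icc : ∀ T A v, q T A v ∈ Set.Icc (0 : ℝ) 1
  self : ∀ T v, q T T v = 0
  mul : ∀ T M A v, T ⊆ M → M ⊆ A → (1 - q T M v) * (1 - q M A v) = 1 - q T A v
  decreasing : ∀ T T' X v, T ⊆ T' → Disjoint T' X → q T' (T' ∪ X) v ≤ q T (T ∪ X) v

section Kernel

variable {V W : Type*} [Fintype V] [DecidableEq V] [DecidableEq W]

/-- The expectation of `f D`, where `D` is the set of active nodes `n` steps after the state in which
the nodes of `A` are active and those of `T` have made their attempts. -/
def kernelExpect (ι : V ↪ W) (q : Finset W → Finset W → V → ℝ) (f : Finset W → ℝ) :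
    ℕ → Finset W → Finset W → ℝ
  | 0, _, A => f A
  | n + 1, T, A => expectSubset Finset.univ (q T A) fun N =>
      kernelExpect ι q f n A (A ∪ N.map ι)

/-- The expectation of `f D` for the final set `D` of active nodes. -/
def kernelFinal (ι : V ↪ W) (q : Finset W → Finset W → V → ℝ) (f : Finset W → ℝ)
    (T A : Finset W) : ℝ :=
  kernelExpect ι q f (Fintype.card V + 1) T A

variable {ι : V ↪ W} {q : Finset W → Finset W → V → ℝ}

lemma expectSubset_kernel_self (hq : IsDecreasingKernel q) (T : Finset W)
    (G : Finset V → ℝ) : expectSubset Finset.univ (q T T) G = G ∅ := by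
  rw [show q T T = fun _ => 0 from funext (hq.self T), expectSubset_zero]

lemma kernelExpect_self (hq : IsDecreasingKernel q) (f : Finset W → ℝ) (n : ℕ) (A : Finset W) :
    kernelExpect ι q f n A A = f A := by
  induction n with
  | zero => rfl
  | succ n ih =>
    rw [kernelExpect, expectSubset_kernel_self hq, Finset.map_empty, Finset.union_empty, ih]

/-- A step either activates a new node in the range of `ι` or leads to a state `(A, A)`, where
nothing more happens. So the number of inactive nodes bounds the number of useful steps. -/
lemma kernelExpect_succ_eq (hq : IsDecreasingKernel q) (f : Finset W → ℝ) (n : ℕ)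
    (T A : Finset W) (hn : (Finset.univ.filter fun v => ι v ∉ A).card ≤ n) :
    kernelExpect ι q f (n + 2) T A = kernelExpect ι q f (n + 1) T A := by
  induction n generalizing T A with
  | zero =>
    rw [kernelExpect, kernelExpect]
    refine expectSubset_congr (fun _ _ => rfl) fun N _ => ?_
    have h : N.map ι ⊆ A := by
      intro x hx
      obtain ⟨v, -, rfl⟩ := Finset.mem_map.1 hx
      by_contra hv
      have := Finset.card_eq_zero.1 (Nat.le_zero.1 hn)
      simpa [hv] using this.subset (Finset.mem_filter.2 ⟨Finset.mem_univ v, hv⟩)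
    rw [Finset.union_eq_left.2 h, kernelExpect_self hq, kernelExpect_self hq]
  | succ n ih =>
    rw [kernelExpect, kernelExpect.eq_def ι q f (n + 1 + 1)]
    refine expectSubset_congr (fun _ _ => rfl) fun N _ => ?_
    by_cases h : N.map ι ⊆ A
    · rw [Finset.union_eq_left.2 h, kernelExpect_self hq, kernelExpect_self hq]
    · refine ih _ _ (Nat.lt_succ_iff.1 (lt_of_lt_of_le (Finset.card_lt_card ?_) hn))
      obtain ⟨x, hx, hxA⟩ := Finset.not_subset.1 h
      obtain ⟨v, hv, rfl⟩ := Finset.mem_map.1 hx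
      refine Finset.ssubset_iff_subset_ne.2 ⟨fun w => ?_, fun heq => ?_⟩
      · simp only [Finset.mem_filter, Finset.mem_union]
        tauto
      · have := heq.symm.subset (Finset.mem_filter.2 ⟨Finset.mem_univ v, hxA⟩)
        simp only [Finset.mem_filter, Finset.mem_union] at this
        tauto

lemma kernelFinal_self (hq : IsDecreasingKernel q) (f : Finset W → ℝ) (A : Finset W) :
    kernelFinal ι q f A A = f A :=
  kernelExpect_self hq f _ A

/-- This fixed-point equation removes the step counter; the inductions on states below run over the
size of `Tᶜ` instead. -/
lemma kernelFinal_step (hq : IsDecreasingKernel q) (f : Finset W → ℝ) (T A : Finset W) :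
    kernelFinal ι q f T A =
      expectSubset Finset.univ (q T A) fun N => kernelFinal ι q f A (A ∪ N.map ι) := by
  rw [kernelFinal, ← kernelExpect_succ_eq hq f (Fintype.card V) T A (Finset.card_filter_le _ _),
    kernelExpect]
  rfl

lemma kernelFinal_sub (f g : Finset W → ℝ) (T A : Finset W) :
    kernelFinal ι q (fun D => f D - g D) T A = kernelFinal ι q f T A - kernelFinal ι q g T A := by
  unfold kernelFinal
  generalize Fintype.card V + 1 = n
  induction n generalizing T A with
  | zero => rfl
  | succ n ih => simp only [kernelExpect, ih, expectSubset_sub]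

lemma kernelFinal_mono (hq : IsDecreasingKernel q) {f g : Finset W → ℝ} (T A : Finset W)
    (hfg : ∀ D, A ⊆ D → f D ≤ g D) : kernelFinal ι q f T A ≤ kernelFinal ι q g T A := by
  unfold kernelFinal
  generalize Fintype.card V + 1 = n
  induction n generalizing T A with
  | zero => exact hfg A le_rfl
  | succ n ih =>
    exact expectSubset_mono (hq.mem_Icc T A) fun N _ => ih _ _ fun D hD =>
      hfg D (Finset.subset_union_left.trans hD)

lemma kernelFinal_const (c : ℝ) (T A : Finset W) : kernelFinal ι q (fun _ => c) T A = c := by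
  unfold kernelFinal
  generalize Fintype.card V + 1 = n
  induction n generalizing T A with
  | zero => rfl
  | succ n ih => simp only [kernelExpect, ih, expectSubset_const]

/-- Order independence: the active nodes outside `M` may wait for those of `M`. -/
lemma kernelFinal_delay [Fintype W] (hq : IsDecreasingKernel q) (f : Finset W → ℝ) (T M A : Finset W)
    (hTM : T ⊆ M) (hMA : M ⊆ A) :
    kernelFinal ι q f T A =
      expectSubset Finset.univ (q T M) fun N => kernelFinal ι q f M (A ∪ N.map ι) := by
  induction h : Tᶜ.card using Nat.strong_induction_on generalizing T M A with
  | _ n ih =>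
    rcases eq_or_ne T M with rfl | hne
    · rw [expectSubset_kernel_self hq, Finset.map_empty, Finset.union_empty]
    · have hlt : Mᶜ.card < n := h ▸ Finset.card_lt_card
        (Finset.compl_ssubset_compl.2 (Finset.ssubset_iff_subset_ne.2 ⟨hTM, hne⟩))
      have hrec (N : Finset V) : kernelFinal ι q f M (A ∪ N.map ι) =
          expectSubset Finset.univ (q M A) fun N₂ =>
            kernelFinal ι q f A (A ∪ (N ∪ N₂).map ι) := by
        rw [ih _ hlt M A (A ∪ N.map ι) hMA Finset.subset_union_left rfl]
        simp only [Finset.map_union, Finset.union_assoc]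
      simp only [hrec]
      -- The draws for the attempts of `M \ T` and then of `A \ M` merge into a single draw for `A \
      -- T`, by `hq.mul`.
      rw [expectSubset_comp _ _ _ fun N => kernelFinal ι q f A (A ∪ N.map ι), kernelFinal_step hq]
      refine expectSubset_congr (fun v _ => ?_) fun _ _ => rfl
      rw [hq.mul T M A v hTM hMA]
      ring

/-- Further nodes may start when the cascade has stopped. -/
lemma kernelFinal_union [Fintype W] (hq : IsDecreasingKernel q) (f : Finset W → ℝ) (T A X : Finset W)
    (hTA : T ⊆ A) :
    kernelFinal ι q f T (A ∪ X) =
      kernelFinal ι q (fun D => kernelFinal ι q f D (D ∪ X)) T A := by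
  induction h : Tᶜ.card using Nat.strong_induction_on generalizing T A with
  | _ n ih =>
    rcases eq_or_ne T A with rfl | hne
    · rw [kernelFinal_self hq]
    · have hlt : Aᶜ.card < n := h ▸ Finset.card_lt_card
        (Finset.compl_ssubset_compl.2 (Finset.ssubset_iff_subset_ne.2 ⟨hTA, hne⟩))
      rw [kernelFinal_delay hq f T A _ hTA Finset.subset_union_left, kernelFinal_step hq]
      refine expectSubset_congr (fun _ _ => rfl) fun N _ => ?_
      rw [← ih _ hlt A (A ∪ N.map ι) Finset.subset_union_left rfl, Finset.union_right_comm]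

lemma le_kernelFinal (hq : IsDecreasingKernel q) {f : Finset W → ℝ}
    (hf : IsMonotoneSubmodular f) (T A : Finset W) : f A ≤ kernelFinal ι q f T A :=
  (kernelFinal_const (ι := ι) (q := q) (f A) T A).symm.le.trans
    (kernelFinal_mono hq T A fun D hD => hf.mono A D hD)

/-- The more nodes have made their attempts, the smaller is the gain of the residual cascade. -/
lemma kernelFinal_gain_le [Fintype W] (hq : IsDecreasingKernel q) {f : Finset W → ℝ}
    (hf : IsMonotoneSubmodular f) (T A T' A' : Finset W) (hTA : T ⊆ A) (hTA' : T' ⊆ A')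
    (hT : T ⊆ T') (hA : A' ⊆ A ∪ T') :
    kernelFinal ι q f T' A' - f T' ≤ kernelFinal ι q f T A - f T := by
  induction h : T'ᶜ.card using Nat.strong_induction_on generalizing T A T' A' with
  | _ n ih =>
    rcases eq_or_ne T' A' with rfl | hne
    · rw [kernelFinal_self hq, sub_self]
      linarith [le_kernelFinal (ι := ι) hq hf T A, hf.mono T A hTA]
    · have hlt : A'ᶜ.card < n := h ▸ Finset.card_lt_card
        (Finset.compl_ssubset_compl.2 (Finset.ssubset_iff_subset_ne.2 ⟨hTA', hne⟩))
      -- `X` holds the nodes about to try in the primed process. They lie in `A`, so in the other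
      -- process they may try first while the rest of `A` waits; having fewer predecessors there,
      -- they succeed at least as often.
      set X := A' \ T' with hX
      have hA'X : T' ∪ X = A' := Finset.union_sdiff_of_subset hTA'
      have hXA : X ⊆ A := fun x hx => by
        have := Finset.mem_sdiff.1 hx
        exact (Finset.mem_union.1 (hA this.1)).resolve_right this.2
      have hle : ∀ v, q T' A' v ≤ q T (T ∪ X) v := fun v => by
        have := hq.decreasing T T' X v hT Finset.disjoint_sdiff
        rwa [hA'X] at this
      have hgain := hf.submodular T T' X hT
      rw [hA'X] at hgain
      -- Coupling gives `N ⊆ N'`, and the new states `(A', A' ∪ N)` and `(T ∪ X, A ∪ N')` again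
      -- satisfy the four inclusions.
      have hcmp : expectSubset Finset.univ (q T' A')
            (fun N => kernelFinal ι q f A' (A' ∪ N.map ι) - f A') ≤
          expectSubset Finset.univ (q T (T ∪ X))
            fun N => kernelFinal ι q f (T ∪ X) (A ∪ N.map ι) - f (T ∪ X) := by
        refine expectSubset_le_of_le (hq.mem_Icc _ _) (hq.mem_Icc _ _) hle fun N N' hN => ?_
        refine ih _ hlt _ _ _ _ ?_ Finset.subset_union_left ?_ ?_ rfl
        · exact (Finset.union_subset hTA hXA).trans Finset.subset_union_left
        · exact (Finset.union_subset_union_left hT).trans hA'X.subset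
        · refine Finset.union_subset Finset.subset_union_right ?_
          exact ((Finset.map_subset_map.2 hN).trans Finset.subset_union_right).trans
            Finset.subset_union_left
      rw [expectSubset_sub, expectSubset_sub, expectSubset_const, expectSubset_const,
        ← kernelFinal_step hq, ← kernelFinal_delay hq f T (T ∪ X) A Finset.subset_union_left
          (Finset.union_subset hTA hXA)] at hcmp
      linarith

/-- In a decreasing cascade, the expected final value of a monotone submodular function is a monotone
submodular function of the set of initially active nodes. -/
lemma isMonotoneSubmodular_kernelFinal [Fintype W] (hq : IsDecreasingKernel q) {f : Finset W → ℝ}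
    (hf : IsMonotoneSubmodular f) : IsMonotoneSubmodular fun A => kernelFinal ι q f ∅ A where
  mono S T h := by
    rw [← Finset.union_eq_right.2 h, kernelFinal_union hq f ∅ S T (Finset.empty_subset _)]
    exact kernelFinal_mono hq _ _ fun D _ =>
      (hf.mono _ _ Finset.subset_union_left).trans (le_kernelFinal hq hf _ _)
  submodular S T X h := by
    have hgain (A : Finset W) : kernelFinal ι q f ∅ (A ∪ X) - kernelFinal ι q f ∅ A =
        kernelFinal ι q (fun D => kernelFinal ι q f D (D ∪ X) - f D) ∅ A := by
      rw [kernelFinal_sub, kernelFinal_union hq f ∅ A X (Finset.empty_subset _)]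
    have hanti : ∀ D D' : Finset W, D ⊆ D' →
        kernelFinal ι q f D' (D' ∪ X) - f D' ≤ kernelFinal ι q f D (D ∪ X) - f D :=
      fun D D' hD => kernelFinal_gain_le hq hf _ _ _ _ Finset.subset_union_left
        Finset.subset_union_left hD (by
          intro x
          simp only [Finset.mem_union]
          tauto)
    rw [hgain, hgain]
    -- Writing `T` as `S ∪ T` runs the cascade of `T` through the final set `D` of the cascade of
    -- `S`; it ends in a superset of `D`, where the residual gain of `X` is no larger.
    conv_lhs => rw [← Finset.union_eq_right.2 h]
    rw [kernelFinal_union hq _ ∅ S T (Finset.empty_subset _)]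
    refine kernelFinal_mono hq _ _ fun D _ => ?_
    refine (kernelFinal_mono hq D (D ∪ T) (g := fun _ => kernelFinal ι q f D (D ∪ X) - f D)
      fun D' hD' => hanti D D' (Finset.subset_union_left.trans hD')).trans ?_
    rw [kernelFinal_const]

end Kernel

/-! # Failure probabilities -/

section failProb

variable {W : Type*} [DecidableEq W]

lemma failProb_append (q : W → Finset W → ℝ) (S : Finset W) (l l' : List W) :
    failProb q S (l ++ l') = failProb q S l * failProb q (S ∪ l.toFinset) l' := by
  induction l generalizing S with
  | nil => simp [failProb]
  | cons u l ih =>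
    rw [List.cons_append, failProb, ih, failProb, List.toFinset_cons, Finset.union_insert,
      Finset.insert_union]
    ring

namespace CascadeModel

variable [Fintype W] {M : CascadeModel W}

lemma IsDecreasingCascade.failProb_mem (hM : M.IsDecreasingCascade) {v : W} (l : List W)
    (S : Finset W) (hS : S ⊆ M.inNbrs v) (hl : l.Nodup) (h : ∀ u ∈ l, u ∈ M.inNbrs v ∧ u ∉ S) :
    failProb (M.p v) S l ∈ Set.Icc (0 : ℝ) 1 := by
  induction l generalizing S with
  | nil => simp [failProb]
  | cons u l ih =>
    rw [List.nodup_cons] at hl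
    obtain ⟨hu, huS⟩ := h u List.mem_cons_self
    have hp := hM.p_mem v u hu S hS huS
    have := ih (insert u S) (Finset.insert_subset hu hS) hl.2 fun w hw =>
      ⟨(h w (List.mem_cons_of_mem _ hw)).1, by
        rw [Finset.mem_insert, not_or]
        exact ⟨fun e => hl.1 (e ▸ hw), (h w (List.mem_cons_of_mem _ hw)).2⟩⟩
    rw [failProb]
    exact ⟨mul_nonneg (sub_nonneg.2 hp.2) this.1,
      mul_le_one₀ (by linarith [hp.1]) this.1 this.2⟩

lemma IsDecreasingCascade.failProb_mono (hM : M.IsDecreasingCascade) {v : W} (l : List W)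
    (S T : Finset W) (hST : S ⊆ T) (hT : T ⊆ M.inNbrs v) (hl : l.Nodup)
    (h : ∀ u ∈ l, u ∈ M.inNbrs v ∧ u ∉ T) :
    failProb (M.p v) S l ≤ failProb (M.p v) T l := by
  induction l generalizing S T with
  | nil => simp [failProb]
  | cons u l ih =>
    rw [List.nodup_cons] at hl
    obtain ⟨hu, huT⟩ := h u List.mem_cons_self
    have hlT : ∀ w ∈ l, w ∈ M.inNbrs v ∧ w ∉ insert u T := fun w hw =>
      ⟨(h w (List.mem_cons_of_mem _ hw)).1, by
        rw [Finset.mem_insert, not_or]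
        exact ⟨fun e => hl.1 (e ▸ hw), (h w (List.mem_cons_of_mem _ hw)).2⟩⟩
    have hST' := Finset.insert_subset_insert u hST
    rw [failProb, failProb]
    refine mul_le_mul ?_ (ih _ _ hST' (Finset.insert_subset hu hT) hl.2 hlT) ?_ ?_
    · linarith [hM.decreasing v u hu S T hST hT huT]
    · exact (hM.failProb_mem l _ (Finset.insert_subset hu (hST.trans hT)) hl.2 fun w hw =>
        ⟨(hlT w hw).1, fun hw' => (hlT w hw).2 (hST' hw')⟩).1
    · linarith [(hM.p_mem v u hu T hT huT).2]

/-- The probability that the attempts of the nodes of `A \ T` on `v` fail, after those of `T`. -/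
noncomputable def setFailProb (M : CascadeModel W) (v : W) (T A : Finset W) : ℝ :=
  failProb (M.p v) (T ∩ M.inNbrs v) ((A \ T) ∩ M.inNbrs v).toList

lemma setFailProb_self (v : W) (T : Finset W) : M.setFailProb v T T = 1 := by
  simp [setFailProb, failProb]

lemma mem_toList_sdiff_inter {v : W} (T A : Finset W) :
    ∀ u ∈ ((A \ T) ∩ M.inNbrs v).toList, u ∈ M.inNbrs v ∧ u ∉ T ∩ M.inNbrs v := by
  intro u
  simp only [Finset.mem_toList, Finset.mem_inter, Finset.mem_sdiff]
  tauto

lemma IsDecreasingCascade.setFailProb_mem (hM : M.IsDecreasingCascade) (v : W) (T A : Finset W) :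
    M.setFailProb v T A ∈ Set.Icc (0 : ℝ) 1 :=
  hM.failProb_mem _ _ Finset.inter_subset_right (Finset.nodup_toList _) (mem_toList_sdiff_inter T A)

/-- This is where order independence enters: listing `B \ T` and then `A \ B` permutes the list of
`A \ T`. -/
lemma IsDecreasingCascade.setFailProb_mul (hM : M.IsDecreasingCascade) (v : W)
    {T B A : Finset W} (hTB : T ⊆ B) (hBA : B ⊆ A) :
    M.setFailProb v T B * M.setFailProb v B A = M.setFailProb v T A := by
  have hB : T ∩ M.inNbrs v ∪ ((B \ T) ∩ M.inNbrs v).toList.toFinset = B ∩ M.inNbrs v := by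
    rw [Finset.toList_toFinset, ← Finset.union_inter_distrib_right,
      Finset.union_sdiff_of_subset hTB]
  have happ := failProb_append (M.p v) (T ∩ M.inNbrs v) ((B \ T) ∩ M.inNbrs v).toList
    ((A \ B) ∩ M.inNbrs v).toList
  rw [hB] at happ
  rw [setFailProb, setFailProb, ← happ, setFailProb]
  have hnodup : (((B \ T) ∩ M.inNbrs v).toList ++ ((A \ B) ∩ M.inNbrs v).toList).Nodup := by
    refine List.Nodup.append (Finset.nodup_toList _) (Finset.nodup_toList _) fun u => ?_
    simp only [Finset.mem_toList, Finset.mem_inter, Finset.mem_sdiff]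
    tauto
  have hperm : (((B \ T) ∩ M.inNbrs v).toList ++ ((A \ B) ∩ M.inNbrs v).toList).Perm
      ((A \ T) ∩ M.inNbrs v).toList := by
    refine (List.perm_ext_iff_of_nodup hnodup (Finset.nodup_toList _)).2 fun u => ?_
    simp only [List.mem_append, Finset.mem_toList, Finset.mem_inter, Finset.mem_sdiff]
    have h₁ := @hTB u
    have h₂ := @hBA u
    tauto
  exact hM.order_independent v _ Finset.inter_subset_right _ _ hperm hnodup fun u hu =>
    mem_toList_sdiff_inter T A u (hperm.mem_iff.1 hu)

/-- Disjointness ensures that the same nodes, those of `X`, make the attempts on both sides. -/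
lemma IsDecreasingCascade.setFailProb_mono (hM : M.IsDecreasingCascade) (v : W)
    {T T' X : Finset W} (hT : T ⊆ T') (hX : Disjoint T' X) :
    M.setFailProb v T (T ∪ X) ≤ M.setFailProb v T' (T' ∪ X) := by
  rw [setFailProb, setFailProb, Finset.union_sdiff_cancel_left hX,
    Finset.union_sdiff_cancel_left (hX.mono_left hT)]
  refine hM.failProb_mono _ _ _ (Finset.inter_subset_inter_right hT) Finset.inter_subset_right
    (Finset.nodup_toList _) fun u hu => ?_
  rw [Finset.mem_toList, Finset.mem_inter] at hu
  exact ⟨hu.2, fun h => Finset.disjoint_left.1 hX (Finset.mem_inter.1 h).1 hu.1⟩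

end CascadeModel

end failProb

/-! # Greedy maximization of monotone submodular functions -/

section Greedy

variable {V : Type*} [DecidableEq V] {f : Finset V → ℝ}

/-- Add the elements of `O` one at a time; by submodularity each gains at most what it would gain
over `B` alone. -/
lemma IsMonotoneSubmodular.sub_le_sum (hf : IsMonotoneSubmodular f) (B O : Finset V) :
    f (B ∪ O) - f B ≤ ∑ w ∈ O, (f (insert w B) - f B) := by
  induction O using Finset.induction_on with
  | empty => simp
  | insert a O ha ih =>
    rw [Finset.sum_insert ha]
    have h := hf.submodular B (B ∪ O) {a} Finset.subset_union_left
    rw [Finset.union_assoc, Finset.union_comm O, ← Finset.insert_eq, Finset.union_comm B {a},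
      ← Finset.insert_eq] at h
    linarith

lemma GreedyRun.subset {U B : Finset V} {k : ℕ} (h : GreedyRun f U k B) : B ⊆ U := by
  induction h with
  | start => exact Finset.empty_subset _
  | select _ hv _ _ ih => exact Finset.insert_subset hv ih
  | exhausted _ _ ih => exact ih

lemma GreedyRun.card_le {U B : Finset V} {k : ℕ} (h : GreedyRun f U k B) : B.card ≤ k := by
  induction h with
  | start => simp
  | select _ _ hvB _ ih => rw [Finset.card_insert_of_notMem hvB]; omega
  | exhausted _ _ ih => omega

/-- The largest marginal gain is at least `(f O - f B) / K`, since at most `K` elements of `O`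
together close the gap. So each selection shrinks the gap by the factor `1 - 1 / K`. -/
lemma GreedyRun.sub_le (hf : IsMonotoneSubmodular f) {U B : Finset V} {k K : ℕ} (hK : 0 < K)
    (h : GreedyRun f U k B) (O : Finset V) (hO : O ⊆ U) (hOK : O.card ≤ K) :
    f O - f B ≤ (1 - 1 / (K : ℝ)) ^ k * (f O - f ∅) := by
  have hK' : (1 : ℝ) ≤ K := by exact_mod_cast hK
  have hbase : 0 ≤ 1 - 1 / (K : ℝ) := sub_nonneg.2 (div_le_one_of_le₀ hK' (by linarith))
  induction h with
  | start => simp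
  | @select k B v _ hv hvB hmax ih =>
    have hgain : 0 ≤ f (insert v B) - f B :=
      sub_nonneg.2 (hf.mono _ _ (Finset.subset_insert v B))
    have hterm : ∀ w ∈ O, f (insert w B) - f B ≤ f (insert v B) - f B := fun w hw => by
      by_cases hwB : w ∈ B
      · rwa [Finset.insert_eq_of_mem hwB, sub_self]
      · exact hmax w (hO hw) hwB
    have h₁ := hf.sub_le_sum B O
    have h₂ := hf.mono O (B ∪ O) Finset.subset_union_right
    have h₃ := Finset.sum_le_card_nsmul O _ _ hterm
    rw [nsmul_eq_mul] at h₃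
    have h₄ : (O.card : ℝ) * (f (insert v B) - f B) ≤ K * (f (insert v B) - f B) :=
      mul_le_mul_of_nonneg_right (by exact_mod_cast hOK) hgain
    have h₅ : (f O - f B) / K ≤ f (insert v B) - f B := by
      rw [div_le_iff₀ (by linarith)]
      linarith
    calc f O - f (insert v B) ≤ (1 - 1 / (K : ℝ)) * (f O - f B) := by
          have : (1 - 1 / (K : ℝ)) * (f O - f B) = (f O - f B) - (f O - f B) / K := by ring
          linarith
      _ ≤ (1 - 1 / (K : ℝ)) * ((1 - 1 / (K : ℝ)) ^ k * (f O - f ∅)) :=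
          mul_le_mul_of_nonneg_left ih hbase
      _ = _ := by ring
  | @exhausted k B _ hUB _ =>
    have h₁ := hf.mono O B (hO.trans hUB)
    have h₂ := hf.mono ∅ O (Finset.empty_subset _)
    have h₃ := mul_nonneg (pow_nonneg hbase (k + 1)) (sub_nonneg.2 h₂)
    linarith

/-- The theorem of Nemhauser, Wolsey, and Fisher. -/
lemma GreedyRun.isApproxSolution (hf : IsMonotoneSubmodular f) (h0 : 0 ≤ f ∅) {U B : Finset V}
    {K : ℕ} (h : GreedyRun f U K B) :
    IsApproxSolution f (fun B' => B'.card ≤ K ∧ B' ⊆ U) (1 - 1 / Real.exp 1) B := by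
  refine ⟨⟨h.card_le, h.subset⟩, fun O ⟨hOK, hO⟩ => ?_⟩
  have hOB : f O - f B ≤ 1 / Real.exp 1 * (f O - f ∅) := by
    have hnonneg : 0 ≤ f O - f ∅ := sub_nonneg.2 (hf.mono ∅ O (Finset.empty_subset _))
    rcases Nat.eq_zero_or_pos K with rfl | hK
    · rw [Finset.card_eq_zero.1 (Nat.le_zero.1 hOK),
        Finset.card_eq_zero.1 (Nat.le_zero.1 h.card_le)]
      simp
    · refine (h.sub_le hf hK O hO hOK).trans (mul_le_mul_of_nonneg_right ?_ hnonneg)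
      have := Real.one_sub_div_pow_le_exp_neg (n := K) (t := 1) (by exact_mod_cast hK)
      rwa [Real.exp_neg, ← one_div] at this
  -- Nonnegativity of `f ∅` turns the bound relative to `f O - f ∅` into one relative to `f O`.
  have : 0 ≤ 1 / Real.exp 1 * f ∅ := by positivity
  linarith

lemma GreedyRun.of_subset {U B : Finset V} {k m : ℕ} (h : GreedyRun f U k B) (hU : U ⊆ B)
    (hkm : k ≤ m) : GreedyRun f U m B := by
  induction m, hkm using Nat.le_induction with
  | base => exact h
  | succ m _ ih => exact ih.exhausted hU

/-- Gains depend only on the kept set, and a member of `R` that is not kept is untried because `B =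
T ∩ R`. So a best untried user who reciprocates is also a best choice within `R`, and dropped users
leave no trace. -/
lemma OnlineGreedyRun.invariant {K : ℕ} {R T B : Finset V} (h : OnlineGreedyRun f K R T B) :
    B = T ∩ R ∧ B.card ≤ K ∧ GreedyRun f R B.card B := by
  induction h with
  | start => exact ⟨by simp, by simp, .start⟩
  | @keep T B v _ hK hvT hmax hvR ih =>
    obtain ⟨hB, -, hrun⟩ := ih
    have hvB : v ∉ B := fun h => hvT (Finset.mem_inter.1 (hB ▸ h)).1
    rw [Finset.card_insert_of_notMem hvB]
    refine ⟨by rw [Finset.insert_inter_of_mem hvR, hB], hK, hrun.select hvR hvB fun w hwR hwB => ?_⟩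
    exact hmax w fun hwT => hwB (hB ▸ Finset.mem_inter.2 ⟨hwT, hwR⟩)
  | drop _ _ _ _ hvR ih => exact ⟨by rw [Finset.insert_inter_of_notMem hvR, ih.1], ih.2⟩

lemma OnlineGreedyOutput.greedyRun [Fintype V] {K : ℕ} {R B : Finset V}
    (h : OnlineGreedyOutput f K R B) : GreedyRun f R K B := by
  obtain ⟨T, hrun, hfinal⟩ := h
  obtain ⟨hB, hcard, hgreedy⟩ := hrun.invariant
  rcases hfinal with h | rfl
  · rwa [h] at hgreedy
  -- All users have been tried, hence `B = R`, and the remaining greedy steps are idle.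
  · exact hgreedy.of_subset (by rw [hB, Finset.univ_inter]) hcard

end Greedy

/-! # The cascade of a social network as a function of the followers of `u₀` -/

namespace SocialNetwork

variable {V : Type*} [Fintype V]

open Classical in
/-- The users who have tried to activate `v`, if `T` is the set of nodes that have made their
attempts, `u₀` being replaced by the nodes `Sum.inl v`, where `Sum.inl v` tries to activate `v`
only. -/
noncomputable def seenBy (v : V) (T : Finset (V ⊕ V)) : Finset (Option V) :=
  Finset.univ.filter fun o => o.elim (Sum.inl v ∈ T) fun u => Sum.inr u ∈ T

open Classical in
/-- Replaces `u₀` by its copies for the users of `F`. -/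
noncomputable def splitSource (F : Finset V) (A : Finset (Option V)) : Finset (V ⊕ V) :=
  Finset.univ.filter fun x => x.elim (fun v => none ∈ A ∧ v ∈ F) fun u => some u ∈ A

lemma none_mem_seenBy {v : V} {T : Finset (V ⊕ V)} : none ∈ seenBy v T ↔ Sum.inl v ∈ T := by
  simp [seenBy]

lemma some_mem_seenBy {u v : V} {T : Finset (V ⊕ V)} :
    some u ∈ seenBy v T ↔ Sum.inr u ∈ T := by
  simp [seenBy]

lemma inl_mem_splitSource {v : V} {F : Finset V} {A : Finset (Option V)} :
    Sum.inl v ∈ splitSource F A ↔ none ∈ A ∧ v ∈ F := by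
  simp [splitSource]

lemma inr_mem_splitSource {u : V} {F : Finset V} {A : Finset (Option V)} :
    Sum.inr u ∈ splitSource F A ↔ some u ∈ A := by
  simp [splitSource]

lemma none_mem_inNbrs_cascade {N : SocialNetwork V} {v : V} {F : Finset V} :
    none ∈ (N.cascade F).inNbrs (some v) ↔ v ∈ F := by
  simp only [CascadeModel.inNbrs, Finset.mem_filter, Finset.mem_univ, true_and]
  rfl

lemma some_mem_inNbrs_cascade {N : SocialNetwork V} {u v : V} {F : Finset V} :
    some u ∈ (N.cascade F).inNbrs (some v) ↔ N.edge u v := by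
  simp only [CascadeModel.inNbrs, Finset.mem_filter, Finset.mem_univ, true_and]
  rfl

variable [DecidableEq V]

lemma isMonotoneSubmodular_expFollowBack (N : SocialNetwork V)
    (hr : ∀ v, N.r v ∈ Set.Icc (0 : ℝ) 1) {g : Finset V → ℝ} (hg : IsMonotoneSubmodular g) :
    IsMonotoneSubmodular (N.expFollowBack g) := by
  have heq (B : Finset V) :
      N.expFollowBack g B = expectSubset Finset.univ N.r fun R => g (B ∩ R) := by
    rw [expFollowBack, expectSubset, Finset.powerset_univ]
  refine ⟨fun S T h => ?_, fun S T X h => ?_⟩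
  · rw [heq, heq]
    exact expectSubset_mono hr fun R _ => hg.mono _ _ (Finset.inter_subset_inter_right h)
  · simp only [heq, ← expectSubset_sub, Finset.union_inter_distrib_right]
    exact expectSubset_mono hr fun R _ =>
      hg.submodular _ _ _ (Finset.inter_subset_inter_right h)

lemma expFollowBack_empty (N : SocialNetwork V) (g : Finset V → ℝ) :
    N.expFollowBack g ∅ = g ∅ := by
  have := expectSubset_const Finset.univ N.r (g ∅)
  rw [expectSubset, Finset.powerset_univ] at this
  simpa only [expFollowBack, Finset.empty_inter] using this

/-- The activation probabilities of the cascade in which `u₀` is replaced by its copies. -/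
noncomputable def splitKernel (N : SocialNetwork V) (T A : Finset (V ⊕ V)) (v : V) : ℝ :=
  1 - (N.cascade Finset.univ).setFailProb (some v) (seenBy v T) (seenBy v A)

lemma isDecreasingKernel_splitKernel {N : SocialNetwork V} (hN : N.IsAdmissible) :
    IsDecreasingKernel N.splitKernel where
  mem_Icc T A v := by
    have := hN.isDecreasingCascade.setFailProb_mem (some v) (seenBy v T) (seenBy v A)
    exact ⟨sub_nonneg.2 this.2, by rw [splitKernel]; linarith [this.1]⟩
  self T v := by rw [splitKernel, CascadeModel.setFailProb_self, sub_self]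
  mul T B A v hTB hBA := by
    have hmono : ∀ {S S' : Finset (V ⊕ V)}, S ⊆ S' → seenBy v S ⊆ seenBy v S' := by
      rintro S S' h (_ | u) <;> simpa [none_mem_seenBy, some_mem_seenBy] using @h _
    simp only [splitKernel, sub_sub_cancel]
    exact hN.isDecreasingCascade.setFailProb_mul (some v) (hmono hTB) (hmono hBA)
  decreasing T T' X v hT hX := by
    have hunion (S : Finset (V ⊕ V)) : seenBy v (S ∪ X) = seenBy v S ∪ seenBy v X := by
      ext (_ | u) <;> simp [none_mem_seenBy, some_mem_seenBy]
    have hdisj : Disjoint (seenBy v T') (seenBy v X) := by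
      rw [Finset.disjoint_left] at hX ⊢
      rintro (_ | u) <;> simpa [none_mem_seenBy, some_mem_seenBy] using @hX _
    have hsub : seenBy v T ⊆ seenBy v T' := by
      rintro (_ | u) <;> simpa [none_mem_seenBy, some_mem_seenBy] using @hT _
    have := hN.isDecreasingCascade.setFailProb_mono (some v) hsub hdisj
    rw [splitKernel, splitKernel, hunion, hunion]
    linarith

/-- Deleting the edge from `u₀` to `v ∉ F` has the same effect on `v` as keeping all edges and
leaving the copy `Sum.inl v` inactive. The success probabilities themselves do not depend on `F`. -/
lemma activationProb_cascade (N : SocialNetwork V) (F : Finset V) {A C : Finset (Option V)}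
    (hC : C ⊆ A) (v : V) : (N.cascade F).activationProb A C (some v) =
      N.splitKernel (splitSource F (A \ C)) (splitSource F A) v := by
  have hinter (T : Finset (Option V)) : T ∩ (N.cascade F).inNbrs (some v) =
      seenBy v (splitSource F T) ∩ (N.cascade Finset.univ).inNbrs (some v) := by
    ext (_ | u)
    · simp [none_mem_seenBy, inl_mem_splitSource, none_mem_inNbrs_cascade]
    · simp [some_mem_seenBy, inr_mem_splitSource, some_mem_inNbrs_cascade]
  have hsdiff : (seenBy v (splitSource F A) \ seenBy v (splitSource F (A \ C))) ∩
      (N.cascade Finset.univ).inNbrs (some v) =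
      seenBy v (splitSource F C) ∩ (N.cascade Finset.univ).inNbrs (some v) := by
    ext (_ | u)
    · have := @hC none
      simp only [none_mem_seenBy, inl_mem_splitSource, Finset.mem_inter, Finset.mem_sdiff]
      tauto
    · have := @hC (some u)
      simp only [some_mem_seenBy, inr_mem_splitSource, Finset.mem_inter, Finset.mem_sdiff]
      tauto
  rw [CascadeModel.activationProb, splitKernel, CascadeModel.setFailProb, hinter, hinter, hsdiff]
  rfl

lemma sum_activeProb_cascade (N : SocialNetwork V) (F : Finset V) (f : Finset (Option V) → ℝ)
    (f' : Finset (V ⊕ V) → ℝ) (hf : ∀ D, none ∈ D → f D = f' (splitSource F D)) (n : ℕ)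
    (A C : Finset (Option V)) (hA : none ∈ A) (hC : C ⊆ A) :
    ∑ D, (N.cascade F).activeProb n A C D * f D =
      kernelExpect Function.Embedding.inr N.splitKernel f' n (splitSource F (A \ C))
        (splitSource F A) := by
  induction n generalizing A C with
  | zero => simp [CascadeModel.activeProb, kernelExpect, hf A hA]
  | succ n ih =>
    have hstep : ∑ D, (N.cascade F).activeProb (n + 1) A C D * f D =
        expectSubset Aᶜ ((N.cascade F).activationProb A C) fun S =>
          ∑ D, (N.cascade F).activeProb n (A ∪ S) S D * f D := by
      simp only [CascadeModel.activeProb, expectSubset, Finset.sum_mul, Finset.mul_sum]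
      rw [Finset.sum_comm]
      exact Finset.sum_congr rfl fun _ _ => Finset.sum_congr rfl fun _ _ => by ring
    have hrec : ∀ S ⊆ Aᶜ, ∑ D, (N.cascade F).activeProb n (A ∪ S) S D * f D =
        kernelExpect Function.Embedding.inr N.splitKernel f' n (splitSource F A)
          (splitSource F (A ∪ S)) := fun S hS => by
      rw [ih (A ∪ S) S (Finset.mem_union_left _ hA) Finset.subset_union_right,
        Finset.union_sdiff_cancel_right
          (Finset.disjoint_left.2 fun x hx hxS => Finset.mem_compl.1 (hS hxS) hx)]
    -- The model draws from `Aᶜ`, the kernel from all of `V`. Drawing active nodes again changes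
    -- nothing, and `u₀ ∈ A`, so both draws extend to the same set.
    have hcover : A ∪ Aᶜ = A ∪ Finset.univ.map Function.Embedding.some := by
      ext (_ | u)
      · simp [hA]
      · simp
    rw [hstep, expectSubset_congr (fun _ _ => rfl) hrec,
      ← expectSubset_union_of_insert_eq _ A _ _ fun a ha S => by
        rw [Finset.union_insert, Finset.insert_eq_of_mem (Finset.mem_union_left _ ha)],
      hcover, expectSubset_union_of_insert_eq _ A _ _ fun a ha S => by
        rw [Finset.union_insert, Finset.insert_eq_of_mem (Finset.mem_union_left _ ha)],
      expectSubset_map, kernelExpect]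
    refine expectSubset_congr (fun v _ => N.activationProb_cascade F hC v) fun S _ => ?_
    congr 1
    ext (v | u) <;> simp [inl_mem_splitSource, inr_mem_splitSource, hA]

lemma expectFinal_cascade (N : SocialNetwork V) (F : Finset V) {f : Finset (Option V) → ℝ}
    {f' : Finset (V ⊕ V) → ℝ} (hf : ∀ D, none ∈ D → f D = f' (splitSource F D)) :
    (N.cascade F).expectFinal {none} f =
      kernelFinal Function.Embedding.inr N.splitKernel f' ∅ (F.map Function.Embedding.inl) := by
  have hstart : splitSource F {none} = F.map Function.Embedding.inl := by
    ext (v | u) <;> simp [inl_mem_splitSource, inr_mem_splitSource]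
  have hempty : splitSource F ∅ = ∅ := by
    ext (v | u) <;> simp [inl_mem_splitSource, inr_mem_splitSource]
  -- The step counts agree because `Option V` has `Fintype.card V + 1` elements.
  rw [CascadeModel.expectFinal,
    N.sum_activeProb_cascade F f f' hf _ {none} {none} (by simp) le_rfl,
    Finset.sdiff_self, hstart, hempty, Fintype.card_option, kernelFinal]

open Classical in
lemma expectFinal_cascade_nonneg {N : SocialNetwork V} (hN : N.IsAdmissible) (F : Finset V)
    {f : Finset (Option V) → ℝ} (hf : ∀ D, 0 ≤ f D) :
    0 ≤ (N.cascade F).expectFinal {none} f := by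
  -- `u₀` is always active, so `D` is recovered from its split version by putting `none` back.
  rw [N.expectFinal_cascade F (f' := fun D =>
    f (Finset.univ.filter fun o => o.elim True fun u => Sum.inr u ∈ D)) fun D hD => ?_]
  · exact (kernelFinal_const 0 _ _).symm.le.trans
      (kernelFinal_mono (isDecreasingKernel_splitKernel hN) _ _ fun D _ => hf _)
  · congr 1
    ext (_ | u) <;> simp [inr_mem_splitSource, hD]

/-- The expected value of a monotone submodular function is a monotone submodular function of the
set of followers of `u₀`. -/
lemma isMonotoneSubmodular_expectFinal {N : SocialNetwork V} (hN : N.IsAdmissible)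
    (f : Finset V → Finset (Option V) → ℝ) (f' : Finset (V ⊕ V) → ℝ)
    (hf : ∀ F D, none ∈ D → f F D = f' (splitSource F D)) (hf' : IsMonotoneSubmodular f') :
    IsMonotoneSubmodular fun F => (N.cascade F).expectFinal {none} (f F) := by
  have hsub := isMonotoneSubmodular_kernelFinal (ι := Function.Embedding.inr)
    (isDecreasingKernel_splitKernel hN) hf'
  refine ⟨fun S T h => ?_, fun S T X h => ?_⟩
  · rw [N.expectFinal_cascade S (hf S), N.expectFinal_cascade T (hf T)]
    exact hsub.mono _ _ (Finset.map_subset_map.2 h)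
  · simp only [fun F => N.expectFinal_cascade F (hf F), Finset.map_union]
    exact hsub.submodular _ _ _ (Finset.map_subset_map.2 h)

lemma isMonotoneSubmodular_expRetweets {N : SocialNetwork V} (hN : N.IsAdmissible) :
    IsMonotoneSubmodular N.expRetweets := by
  refine isMonotoneSubmodular_expectFinal hN _ _ (fun F D _ => ?_)
    (isMonotoneSubmodular_card_biUnion (Sum.elim (fun _ => ∅) fun u => {u}))
  congr 2
  ext v
  simp [retweeters, inr_mem_splitSource]

-- The copy `Sum.inl v` covers `v`, and `Sum.inr u` covers `u` and its followers. Thus the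
-- dependence of the readers on `F` is absorbed by the active copies of `u₀`, and the coverage
-- function does not involve `F`.
open Classical in
lemma isMonotoneSubmodular_expReaders {N : SocialNetwork V} (hN : N.IsAdmissible) :
    IsMonotoneSubmodular N.expReaders := by
  refine isMonotoneSubmodular_expectFinal hN _ _ (fun F D hD => ?_)
    (isMonotoneSubmodular_card_biUnion (Sum.elim (fun v => {v}) fun u =>
      insert u (Finset.univ.filter (N.edge u))))
  congr 2
  ext v
  simp [readers, inl_mem_splitSource, inr_mem_splitSource, edgeWith, Option.exists, hD]
  grind

end SocialNetwork

lemma greedyRatio_of_isMonotoneSubmodular {V : Type*} [Fintype V] [DecidableEq V]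
    (N : SocialNetwork V) (hN : N.IsAdmissible) (K : ℕ) {g : Finset V → ℝ}
    (hg : IsMonotoneSubmodular g) (h0 : 0 ≤ g ∅) :
    StaticGreedyRatio N g K (1 - 1 / Real.exp 1) ∧
      DynamicGreedyRatio g K (1 - 1 / Real.exp 1) := by
  refine ⟨fun B hB => ?_, fun R B hB => ?_⟩
  · have := hB.isApproxSolution (N.isMonotoneSubmodular_expFollowBack hN.r_mem hg)
      (by rwa [N.expFollowBack_empty])
    exact ⟨this.1.1, fun O hO => this.2 O ⟨hO, Finset.subset_univ O⟩⟩
  · exact (hB.elim id OnlineGreedyOutput.greedyRun).isApproxSolution hg h0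

theorem proposition5 {V : Type*} [Fintype V] [DecidableEq V] (N : SocialNetwork V)
    (hN : N.IsAdmissible) (K : ℕ) :
    (StaticGreedyRatio N N.expRetweets K (1 - 1 / Real.exp 1) ∧
      DynamicGreedyRatio N.expRetweets K (1 - 1 / Real.exp 1)) ∧
    (StaticGreedyRatio N N.expReaders K (1 - 1 / Real.exp 1) ∧
      DynamicGreedyRatio N.expReaders K (1 - 1 / Real.exp 1)) := by
  refine ⟨greedyRatio_of_isMonotoneSubmodular N hN K
      (SocialNetwork.isMonotoneSubmodular_expRetweets hN) ?_,
    greedyRatio_of_isMonotoneSubmodular N hN K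
      (SocialNetwork.isMonotoneSubmodular_expReaders hN) ?_⟩
  all_goals exact SocialNetwork.expectFinal_cascade_nonneg hN ∅ fun D => Nat.cast_nonneg _
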